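/- Let $\mathbf D=\{z\in\mathbb C:|z|\le 1\}$, let $C(\mathbf D,\mathbb C)$ be the algebra of continuous complex-valued functions on $\mathbf D$ with the supremum norm, and let the cone algebra $A_{co}\subseteq C(\mathbf D,\mathbb C)$ be the uniformly closed unital complex subalgebra generated by the functions $z\mapsto z$ and $z\mapsto |z|$. For a commutative unital Banach algebra $A$ and an integer $n\ge 1$, let $$U_n(A)=\Big\{(f_1,\dots,f_n)\in A^n:\ \exists\,(r_1,\dots,r_n)\in A^n,\ \sum_{j=1}^n r_jf_j=1\Big\}.$$ A tuple $(f_1,\dots,f_n,g)\in U_{n+1}(A)$ is called reducible if there is $(a_1,\dots,a_n)\in A^n$ with $(f_1+a_1g,\dots,f_n+a_ng)\in U_n(A)$. The Bass stable rank $\operatorname{bsr}A$ is the least integer $n\ge 1$ such that every element of $U_{n+1}(A)$ is reducible ($\infty$ if there is no such $n$), and the topological stable rank $\operatorname{tsr}A$ is the least integer $n\ge 1$ such that $U_n(A)$ is dense in $A^n$ ($\infty$ if there is no such $n$). **Theorem.** $\operatorname{bsr}A_{co}=2$ and $\operatorname{tsr}A_{co}=2$. -/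

import Mathlib

/-- `U_n(A)`: the set of invertible `n`-tuples `(f₁, …, fₙ)` of a commutative ring `A`, that is those
for which the Bézout equation `∑ rⱼ fⱼ = 1` has a solution in `A`. -/
def invertibleTuples (A : Type*) [CommRing A] (n : ℕ) : Set (Fin n → A) :=
  {f | ∃ r : Fin n → A, ∑ j, r j * f j = 1}

/-- A tuple `F = (f₁, …, fₙ, g)` is reducible if there are `a₁, …, aₙ` in `A` such that
`(f₁ + a₁ g, …, fₙ + aₙ g)` is an invertible `n`-tuple. -/
def IsReducibleTuple {A : Type*} [CommRing A] {n : ℕ} (F : Fin (n + 1) → A) : Prop :=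
  ∃ a : Fin n → A, (fun j : Fin n => F j.castSucc + a j * F (Fin.last n)) ∈ invertibleTuples A n

/-- The Bass stable rank: the least integer `n ≥ 1` such that every element of `U_{n+1}(A)` is
reducible, and `∞` if there is none. -/
noncomputable def bassStableRank (A : Type*) [CommRing A] : ℕ∞ :=
  ⨅ (n : ℕ) (_ : 1 ≤ n ∧ ∀ F ∈ invertibleTuples A (n + 1), IsReducibleTuple F), (n : ℕ∞)

/-- The topological stable rank: the least integer `n ≥ 1` such that `U_n(A)` is dense in `A^n`
(with the product topology), and `∞` if there is none. -/
noncomputable def topologicalStableRank (A : Type*) [CommRing A] [TopologicalSpace A] : ℕ∞ :=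
  ⨅ (n : ℕ) (_ : 1 ≤ n ∧ Dense (invertibleTuples A n)), (n : ℕ∞)

/-- The closed unit disk in `ℂ`, as a type. -/
abbrev ClosedDisk : Type := Metric.closedBall (0 : ℂ) 1

/-- The function `z ↦ z` on the closed unit disk. -/
def diskCoord : C(ClosedDisk, ℂ) where
  toFun z := (z : ℂ)
  continuous_toFun := by fun_prop

/-- The function `z ↦ |z|` on the closed unit disk. -/
noncomputable def diskAbs : C(ClosedDisk, ℂ) where
  toFun z := ((‖(z : ℂ)‖ : ℝ) : ℂ)
  continuous_toFun := by fun_prop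

/-- The cone algebra: the uniformly closed unital subalgebra of the continuous complex-valued
functions on the closed unit disk generated by `z` and `|z|`. Since the disk is compact, the topology
of `C(ClosedDisk, ℂ)` is the one of the supremum norm. -/
noncomputable def coneAlgebra : Subalgebra ℂ C(ClosedDisk, ℂ) :=
  (Algebra.adjoin ℂ {diskCoord, diskAbs}).topologicalClosure

/-! Upper bounds: a character is determined by its values on `z` and `|z|`, the latter real, so it
is a point of `ℂ × ℝ`. A pair of polynomials maps this real 3-dimensional space smoothly into `ℂ²`,
of real dimension 4, so arbitrarily small constant shifts remove all common zeros. Density of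
invertible tuples then bounds the Bass stable rank too.

Lower bounds: by the maximum principle, polynomials in `z, |z|` are controlled on the solid cone
`|z| ≤ t ≤ 1`. Its slice by real `z` contains a disk, on whose boundary `g` vanishes while `f` winds
once; hence `f + a g` cannot be invertible. -/

/-- Perturb the first `n` Bézout coefficients to an invertible tuple `s`, keeping the Bézout sum a
unit. If `∑ cⱼ sⱼ = 1`, then `aⱼ = cⱼ rₙ` works. -/
theorem isReducibleTuple_of_dense_invertibleTuples {A : Type*} [NormedCommRing A] [CompleteSpace A]
    {n : ℕ} (hd : Dense (invertibleTuples A n)) {F : Fin (n + 1) → A}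
    (hF : F ∈ invertibleTuples A (n + 1)) : IsReducibleTuple F := by
  obtain ⟨r, hr⟩ := hF
  have hcont : Continuous fun s : Fin n → A =>
      ∑ j, s j * F j.castSucc + r (Fin.last n) * F (Fin.last n) := by fun_prop
  obtain ⟨s, hs, c, hc⟩ := hd.inter_open_nonempty _ (Units.isOpen.preimage hcont)
    ⟨fun j => r j.castSucc, by
      rw [Set.mem_preimage, ← Fin.sum_univ_castSucc (fun j => r j * F j), hr]; exact isUnit_one⟩
  obtain ⟨u, hu⟩ := hs
  simp only at hu
  refine ⟨fun j => c j * r (Fin.last n), fun j => ↑u⁻¹ * s j, ?_⟩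
  calc ∑ j, ↑u⁻¹ * s j * (F j.castSucc + c j * r (Fin.last n) * F (Fin.last n))
      = ↑u⁻¹ * (∑ j, s j * F j.castSucc
          + (∑ j, c j * s j) * (r (Fin.last n) * F (Fin.last n))) := by
        rw [Finset.sum_mul, ← Finset.sum_add_distrib, Finset.mul_sum]
        exact Finset.sum_congr rfl fun j _ => by ring
    _ = 1 := by rw [hc, one_mul, ← hu, Units.inv_mul]

theorem exists_algHom_eq_zero_of_notMem_invertibleTuples {A : Type*} [NormedCommRing A]
    [NormedAlgebra ℂ A] [CompleteSpace A] {n : ℕ} {f : Fin n → A}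
    (hf : f ∉ invertibleTuples A n) : ∃ φ : A →ₐ[ℂ] ℂ, ∀ j, φ (f j) = 0 := by
  have hne : Ideal.span (Set.range f) ≠ ⊤ := by
    intro h
    have h1 := (Ideal.eq_top_iff_one _).1 h
    rw [Ideal.mem_span_range_iff_exists_fun] at h1
    exact hf h1
  obtain ⟨M, hM, hle⟩ := Ideal.exists_le_maximal _ hne
  exact ⟨WeakDual.CharacterSpace.toAlgHom M.toCharacterSpace, fun j =>
    M.toCharacterSpace_apply_eq_zero_of_mem (hle (Ideal.subset_span ⟨j, rfl⟩))⟩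

/-- Without zeros, `G` composed with the radial retraction has a continuous logarithm `h`. Then
`h(e^{iθ}) - iθ` is a logarithm of `c`, hence constant, yet it drops by `2πi` over one turn. -/
theorem exists_eq_zero_of_eqOn_sphere {G : ℂ → ℂ} (hG : ContinuousOn G (Metric.closedBall 0 1))
    {c : ℂ} (hc : ∀ w ∈ Metric.sphere (0 : ℂ) 1, G w = c * w) :
    ∃ w ∈ Metric.closedBall (0 : ℂ) 1, G w = 0 := by
  by_contra! h0
  have hmax : ∀ w : ℂ, (0 : ℝ) < max 1 ‖w‖ := fun w => lt_max_of_lt_left one_pos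
  let ret : ℂ → ℂ := fun w => w / ((max 1 ‖w‖ : ℝ) : ℂ)
  have hret : Continuous ret := by
    refine continuous_id.div (by fun_prop) fun w => ?_
    exact_mod_cast (hmax w).ne'
  have hret_mem : ∀ w, ret w ∈ Metric.closedBall (0 : ℂ) 1 := by
    intro w
    rw [mem_closedBall_zero_iff, norm_div, Complex.norm_real, Real.norm_of_nonneg (hmax w).le]
    exact div_le_one_of_le₀ (le_max_right _ _) (hmax w).le
  have hret_eq : ∀ w ∈ Metric.sphere (0 : ℂ) 1, ret w = w := by
    intro w hw
    simp [ret, mem_sphere_zero_iff_norm.1 hw]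
  let f : C(ℂ, ℂ) := ⟨fun w => G (ret w), hG.comp_continuous hret hret_mem⟩
  have hf : ∀ w, f w ≠ 0 := fun w => h0 _ (hret_mem w)
  obtain ⟨h, ⟨-, hh⟩, -⟩ := Complex.isCoveringMapOn_exp.existsUnique_continuousMap_lifts f
    (a₀ := 0) (Complex.exp_log (hf 0)) hf
  have hexp : ∀ w, Complex.exp (h w) = G (ret w) := fun w => congr_fun hh w
  let k : ℝ → ℂ := fun θ => h (Complex.exp (θ * Complex.I)) - θ * Complex.I
  have hk : Continuous k := by fun_prop
  have hkexp : ∀ θ, Complex.exp (k θ) = c := by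
    intro θ
    have hm : Complex.exp (θ * Complex.I) ∈ Metric.sphere (0 : ℂ) 1 := by
      simp [Complex.norm_exp_ofReal_mul_I]
    rw [Complex.exp_sub, hexp, hret_eq _ hm, hc _ hm, mul_div_cancel_right₀ _ (Complex.exp_ne_zero _)]
  have := Complex.isCoveringMap_exp.const_of_comp hk
    (fun a a' => Subtype.ext ((hkexp a).trans (hkexp a').symm)) 0 (2 * Real.pi)
  simp only [k, Complex.ofReal_zero, zero_mul, Complex.exp_zero, Complex.ofReal_mul,
    Complex.ofReal_ofNat, Complex.exp_two_pi_mul_I, sub_zero] at this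
  exact Complex.two_pi_I_ne_zero (by linear_combination this)

namespace coneAlgebra

instance : CompleteSpace coneAlgebra :=
  (Subalgebra.isClosed_topologicalClosure _).completeSpace_coe

instance : NormOneClass coneAlgebra := ⟨norm_one (α := C(ClosedDisk, ℂ))⟩

/-- The function `z ↦ z` as an element of the cone algebra. -/
noncomputable def coord : coneAlgebra :=
  ⟨diskCoord, Subalgebra.le_topologicalClosure _ (Algebra.subset_adjoin (by simp))⟩

/-- The function `z ↦ |z|` as an element of the cone algebra. -/
noncomputable def absVal : coneAlgebra :=
  ⟨diskAbs, Subalgebra.le_topologicalClosure _ (Algebra.subset_adjoin (by simp))⟩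

/-- The polynomials in `z` and `|z|`. -/
noncomputable def polyHom : MvPolynomial (Fin 2) ℂ →ₐ[ℂ] coneAlgebra :=
  MvPolynomial.aeval ![coord, absVal]

theorem coe_polyHom_apply (P : MvPolynomial (Fin 2) ℂ) (z : ClosedDisk) :
    (polyHom P : C(ClosedDisk, ℂ)) z = MvPolynomial.eval ![(z : ℂ), ((‖(z : ℂ)‖ : ℝ) : ℂ)] P := by
  induction P using MvPolynomial.induction_on with
  | C a => simp [polyHom]
  | add p q hp hq => simp [hp, hq]
  | mul_X p i hp => 
    rw [map_mul, map_mul, ← hp]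
    fin_cases i <;> simp [polyHom, coord, absVal, diskCoord, diskAbs]

theorem denseRange_polyHom : DenseRange polyHom := by
  intro f
  rw [Metric.mem_closure_iff]
  intro ε hε
  obtain ⟨g, hg, hfg⟩ := Metric.mem_closure_iff.1 f.2 ε hε
  have : g ∈ (coneAlgebra.val.comp polyHom).range := by
    refine Algebra.adjoin_le (S := (coneAlgebra.val.comp polyHom).range) ?_ hg
    rintro _ (rfl | rfl)
    · exact ⟨MvPolynomial.X 0, by simp [polyHom, coord]⟩
    · exact ⟨MvPolynomial.X 1, by simp [polyHom, absVal]⟩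
  obtain ⟨P, rfl⟩ := this
  exact ⟨_, ⟨P, rfl⟩, hfg⟩

theorem algHom_polyHom (φ : coneAlgebra →ₐ[ℂ] ℂ) (P : MvPolynomial (Fin 2) ℂ) :
    φ (polyHom P) = MvPolynomial.eval ![φ coord, φ absVal] P := by
  induction P using MvPolynomial.induction_on with
  | C a => simp [polyHom]
  | add p q hp hq => simp [hp, hq]
  | mul_X p i hp =>
    rw [map_mul, map_mul, map_mul, hp]
    fin_cases i <;> simp [polyHom]

/-- Arens' trick: characters are contractive and `|z|` is real-valued, so imaginary shifts bound the
imaginary part. -/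
theorem im_algHom_absVal (φ : coneAlgebra →ₐ[ℂ] ℂ) : (φ absVal).im = 0 := by
  have key : ∀ s : ℝ, ‖φ absVal + s * Complex.I‖ ^ 2 ≤ 1 + s ^ 2 := by
    intro s
    have h1 : φ (absVal + algebraMap ℂ _ (s * Complex.I)) = φ absVal + s * Complex.I := by simp
    rw [← h1]
    refine (pow_le_pow_left₀ (norm_nonneg _) (AlgHom.norm_apply_le_self φ _) 2).trans ?_
    refine (Real.le_sqrt (norm_nonneg _) (by positivity)).1 ?_
    refine (ContinuousMap.norm_le _ (Real.sqrt_nonneg _)).2 fun z => ?_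
    refine Real.le_sqrt_of_sq_le ?_
    have hz : ‖(z : ℂ)‖ ≤ 1 := mem_closedBall_zero_iff.1 z.2
    have : (absVal + algebraMap ℂ coneAlgebra (s * Complex.I) : C(ClosedDisk, ℂ)) z
        = ((‖(z : ℂ)‖ : ℝ) : ℂ) + s * Complex.I := by simp [absVal, diskAbs]
    erw [this]
    rw [Complex.sq_norm, Complex.normSq_add_mul_I]
    nlinarith [norm_nonneg (z : ℂ)]
  by_contra hb
  have h2 := key (1 / (φ absVal).im)
  rw [Complex.sq_norm, Complex.normSq_apply] at h2
  have h3 : (φ absVal).im * (1 / (φ absVal).im) = 1 := mul_one_div_cancel hb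
  simp only [Complex.add_re, Complex.add_im, Complex.re_ofReal_mul, Complex.im_ofReal_mul,
    Complex.I_re, Complex.I_im, mul_zero, add_zero, mul_one] at h2
  nlinarith [mul_self_nonneg (φ absVal).re, mul_self_nonneg (φ absVal).im]

theorem contDiff_eval {𝕜 E : Type*} [NontriviallyNormedField 𝕜] [NormedAlgebra 𝕜 ℂ]
    [NormedAddCommGroup E] [NormedSpace 𝕜 E] {x y : E → ℂ} (hx : ContDiff 𝕜 1 x)
    (hy : ContDiff 𝕜 1 y) (P : MvPolynomial (Fin 2) ℂ) :
    ContDiff 𝕜 1 fun e => MvPolynomial.eval ![x e, y e] P := by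
  induction P using MvPolynomial.induction_on with
  | C a => simpa using contDiff_const
  | add p q hp hq => simpa using hp.add hq
  | mul_X p i hp =>
    simp only [map_mul, MvPolynomial.eval_X]
    refine hp.mul ?_
    fin_cases i
    exacts [hx, hy]

/-- The maximum principle on the solid cone `|z| ≤ t ≤ 1`. -/
theorem norm_eval_le (P : MvPolynomial (Fin 2) ℂ) {z : ℂ} {t : ℝ} (hzt : ‖z‖ ≤ t) (ht : t ≤ 1) :
    ‖MvPolynomial.eval ![z, (t : ℂ)] P‖ ≤ ‖polyHom P‖ := by
  have hbd : ∀ w : ℂ, ‖w‖ = t → ‖MvPolynomial.eval ![w, (t : ℂ)] P‖ ≤ ‖polyHom P‖ := by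
    intro w hw
    have := (polyHom P : C(ClosedDisk, ℂ)).norm_coe_le_norm
      ⟨w, mem_closedBall_zero_iff.2 (hw.trans_le ht)⟩
    subst hw
    rwa [coe_polyHom_apply] at this
  rcases hzt.eq_or_lt with h | h
  · exact hbd z h
  have hd : Differentiable ℂ fun w => MvPolynomial.eval ![w, (t : ℂ)] P :=
    (contDiff_eval contDiff_id contDiff_const P).differentiable one_ne_zero
  have ht0 : t ≠ 0 := ((norm_nonneg z).trans_lt h).ne'
  refine Complex.norm_le_of_forall_mem_frontier_norm_le (U := Metric.ball 0 t)
    Metric.isBounded_ball hd.diffContOnCl (fun w hw => hbd w ?_)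
    (subset_closure (mem_ball_zero_iff.2 h))
  rwa [frontier_ball _ ht0, mem_sphere_zero_iff_norm] at hw

theorem dense_invertibleTuples_two : Dense (invertibleTuples coneAlgebra 2) := by
  have hpoly : ∀ P : Fin 2 → MvPolynomial (Fin 2) ℂ,
      (fun j => polyHom (P j)) ∈ closure (invertibleTuples coneAlgebra 2) := by
    intro P
    have hsm : ContDiff ℝ 1 fun (e : ℂ × ℝ) (j : Fin 2) =>
        MvPolynomial.eval ![e.1, (e.2 : ℂ)] (P j) :=
      contDiff_pi.2 fun j => contDiff_eval contDiff_fst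
        (Complex.ofRealCLM.contDiff.comp contDiff_snd) (P j)
    have hdense := hsm.dense_compl_range_of_finrank_lt_finrank (by
      simp [Module.finrank_pi_fintype, Complex.finrank_real_complex])
    have hcont : Continuous fun (c : Fin 2 → ℂ) (j : Fin 2) =>
        polyHom (P j) - algebraMap ℂ coneAlgebra (c j) := by fun_prop
    have := map_mem_closure hcont (hdense 0) (t := invertibleTuples coneAlgebra 2) ?_
    · simpa using this
    -- A character killing both shifted entries would exhibit `c` as a value of the map.
    intro c hc
    by_contra hni
    obtain ⟨φ, hφ⟩ := exists_algHom_eq_zero_of_notMem_invertibleTuples hni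
    refine hc ⟨(φ coord, (φ absVal).re), funext fun j => ?_⟩
    have hre : (((φ absVal).re : ℝ) : ℂ) = φ absVal :=
      Complex.ext rfl (im_algHom_absVal φ).symm
    have := hφ j
    rw [map_sub, algHom_polyHom, AlgHom.commutes, sub_eq_zero] at this
    simpa [hre] using this
  have hd : DenseRange fun (P : Fin 2 → MvPolynomial (Fin 2) ℂ) j => polyHom (P j) :=
    DenseRange.piMap fun _ => denseRange_polyHom
  exact dense_closure.1 (hd.mono (Set.range_subset_iff.2 hpoly))

theorem exists_mem_invertibleTuples_not_isReducibleTuple :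
    ∃ F ∈ invertibleTuples coneAlgebra 2, ¬ IsReducibleTuple F := by
  -- For real `z` and `t`, `f'` is the conjugate of `f`, so `g = |f|² - 1/16`.
  let f : MvPolynomial (Fin 2) ℂ := .X 0 + .C Complex.I * (.X 1 - .C (3 / 4))
  let f' : MvPolynomial (Fin 2) ℂ := .X 0 - .C Complex.I * (.X 1 - .C (3 / 4))
  let g : MvPolynomial (Fin 2) ℂ := f * f' - .C (1 / 16)
  refine ⟨![polyHom f, polyHom g], ⟨![polyHom (.C 16 * f'), polyHom (.C (-16))], ?_⟩, ?_⟩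
  · have h : MvPolynomial.C 16 * f' * f + MvPolynomial.C (-16) * g = 1 := by
      have : (MvPolynomial.C 16 * .C (1 / 16) : MvPolynomial (Fin 2) ℂ) = 1 := by
        rw [← MvPolynomial.C_mul]; norm_num
      simp only [g, MvPolynomial.C_neg]
      linear_combination this
    have h' := congrArg polyHom h
    rw [map_add, map_mul polyHom (_ * f') f, map_mul polyHom _ g, map_one] at h'
    rw [Fin.sum_univ_two]
    exact h'
  rintro ⟨a, r, h⟩
  replace h : r 0 * (polyHom f + a 0 * polyHom g) = 1 := by simpa using h
  -- Polynomial approximants suffice, and `norm_eval_le` applies to them.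
  have hcont : Continuous fun p : coneAlgebra × coneAlgebra =>
      ‖p.1 * (polyHom f + p.2 * polyHom g) - 1‖ := by fun_prop
  obtain ⟨⟨R, S⟩, hRS⟩ := (denseRange_polyHom.prodMap denseRange_polyHom).exists_mem_open
    (isOpen_Iio.preimage hcont) ⟨(r 0, a 0), by
      change ‖r 0 * (polyHom f + a 0 * polyHom g) - 1‖ < 1
      rw [h, sub_self, norm_zero]
      exact one_pos⟩
  replace hRS : ‖polyHom (R * (f + S * g) - 1)‖ < 1 := by
    rw [map_sub, map_mul, map_add, map_mul, map_one]
    exact hRS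
  -- The disk of radius 1/4 about `(0, 3/4)` lies in the cone, as `|x| ≤ 1/4 < 1/2 ≤ t ≤ 1`; on it
  -- `f = w / 4`.
  let param : ℂ → Fin 2 → ℂ := fun w => ![((w.re / 4 : ℝ) : ℂ), ((3 / 4 + w.im / 4 : ℝ) : ℂ)]
  obtain ⟨w, hw, h0⟩ := exists_eq_zero_of_eqOn_sphere
    (G := fun w => MvPolynomial.eval (param w) (f + S * g)) (c := 1 / 4)
    (by
      refine (MvPolynomial.continuous_eval _).comp_continuousOn (Continuous.continuousOn ?_)
      refine continuous_pi fun i => ?_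
      fin_cases i <;> simp only [param] <;> fun_prop)
    (by
      intro w hw
      have hf : MvPolynomial.eval (param w) f = 1 / 4 * w := by
        simp [f, param]
        linear_combination (1 / 4) * Complex.re_add_im w
      have hf' : MvPolynomial.eval (param w) f' = 1 / 4 * (starRingEnd ℂ) w := by
        have hconj : (starRingEnd ℂ) w = w.re - w.im * Complex.I := by
          apply Complex.ext <;> simp
        simp [f', param, hconj]
        ring
      have hg : MvPolynomial.eval (param w) g = 0 := by
        have : w * (starRingEnd ℂ) w = 1 := by
          rw [Complex.mul_conj, Complex.normSq_eq_norm_sq, mem_sphere_zero_iff_norm.1 hw]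
          simp
        simp only [g, map_sub, map_mul, hf, hf', MvPolynomial.eval_C]
        linear_combination (1 / 16) * this
      simp [hf, hg])
  have hw1 := mem_closedBall_zero_iff.1 hw
  have hre := abs_le.1 ((Complex.abs_re_le_norm w).trans hw1)
  have him := abs_le.1 ((Complex.abs_im_le_norm w).trans hw1)
  have := norm_eval_le (R * (f + S * g) - 1) (z := ((w.re / 4 : ℝ) : ℂ))
    (t := 3 / 4 + w.im / 4) (by rw [Complex.norm_real, Real.norm_eq_abs, abs_le]
                                constructor <;> linarith) (by linarith)
  have heval : MvPolynomial.eval (param w) (R * (f + S * g) - 1) = -1 := by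
    rw [map_sub, map_mul, h0, mul_zero, map_one, zero_sub]
  change ‖MvPolynomial.eval (param w) _‖ ≤ _ at this
  rw [heval, norm_neg, norm_one] at this
  exact this.not_gt hRS

theorem isReducibleTuple_of_mem_invertibleTuples_three :
    ∀ F ∈ invertibleTuples coneAlgebra 3, IsReducibleTuple F :=
  fun _ hF => isReducibleTuple_of_dense_invertibleTuples dense_invertibleTuples_two hF

end coneAlgebra

theorem iInf_natCast_eq_two {p : ℕ → Prop} (h1 : ¬ p 1) (h2 : p 2) :
    ⨅ (n : ℕ) (_ : 1 ≤ n ∧ p n), (n : ℕ∞) = 2 := by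
  refine le_antisymm (iInf₂_le 2 ⟨one_le_two, h2⟩) (le_iInf₂ fun n hn => ?_)
  obtain ⟨hn, hp⟩ := hn
  have : n ≠ 1 := by rintro rfl; exact h1 hp
  exact_mod_cast (show 2 ≤ n by omega)

theorem mainTheorem2 :
    bassStableRank coneAlgebra = 2 ∧ topologicalStableRank coneAlgebra = 2 := by
  obtain ⟨F, hF, hFr⟩ := coneAlgebra.exists_mem_invertibleTuples_not_isReducibleTuple
  exact ⟨iInf_natCast_eq_two (fun h => hFr (h F hF))
      coneAlgebra.isReducibleTuple_of_mem_invertibleTuples_three,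
    iInf_natCast_eq_two (fun h => hFr (isReducibleTuple_of_dense_invertibleTuples h hF))
      coneAlgebra.dense_invertibleTuples_two⟩
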